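/- Let $n\ge 1$ be an integer, $1\le p<\infty$, $\frac1p+\frac1{p'}=1$ (so $\frac n{p'}=n(1-\frac1p)$, which is $0$ for $p=1$), and let $\gamma$ be a real number with $\gamma<\frac{n}{p'}$. Then there is a constant $C$, depending only on $n,p,\gamma$, with the following property. Let $f:\mathbb R^n\to\mathbb R$ be radial, $f(x)=f_0(|x|)$, such that $r\mapsto f_0(r)\,r^{\frac{n-1}{2}}$ is non-increasing on $(0,\infty)$ and tends to $0$ as $r\to\infty$. Then the Pitt inequality $$\int_{\mathbb R^n}|\widehat f(\xi)|^p\,|\xi|^{n(p-2)-\gamma p}\,d\xi\;\le\; C\int_{\mathbb R^n}|f(x)|^p\,|x|^{\gamma p}\,dx$$ holds, where the Fourier transform is $$\widehat f(\xi)=\lim_{N\to\infty}\int_{|x|\le N}f(x)\,e^{-2\pi i(x,\xi)}\,dx ,$$ and both sides are read in $[0,\infty]$ (there is nothing to prove when the right-hand side is infinite). Moreover, whenever the right-hand side is finite, $f$ is locally integrable and this limit exists for every $\xi\ne0$, so that $\widehat f$ is well defined almost everywhere. -/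

import Mathlib

open MeasureTheory Filter Topology Set
open scoped FourierTransform NNReal ENNReal

/-- The truncated Fourier integral `∫_{|x| ≤ N} f(x) e^{-2πi⟨x, ξ⟩} dx` of a real function `f`
on `ℝⁿ`, that is, the Fourier transform of `f · 1_{|x| ≤ N}`. -/
noncomputable def ballFourier {n : ℕ} (f : EuclideanSpace ℝ (Fin n) → ℝ) (N : ℝ)
    (ξ : EuclideanSpace ℝ (Fin n)) : ℂ :=
  𝓕 ((Metric.closedBall (0 : EuclideanSpace ℝ (Fin n)) N).indicator (fun x => (f x : ℂ))) ξ

/-- The Fourier transform of a function on `ℝⁿ` that need not be integrable at infinity, as the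
limit for `N → ∞` of the Fourier integrals over the balls `|x| ≤ N`. -/
noncomputable def radialFourier {n : ℕ} (f : EuclideanSpace ℝ (Fin n) → ℝ)
    (ξ : EuclideanSpace ℝ (Fin n)) : ℂ :=
  limUnder atTop (fun N : ℝ => ballFourier f N ξ)

/-- The truncated Fourier transform as an explicit integral over the ball. -/
theorem ballFourier_eq {n : ℕ} (f : EuclideanSpace ℝ (Fin n) → ℝ) (N : ℝ)
    (ξ : EuclideanSpace ℝ (Fin n)) :
    ballFourier f N ξ = ∫ x in Metric.closedBall (0 : EuclideanSpace ℝ (Fin n)) N,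
      Complex.exp (((-2 * Real.pi * inner ℝ x ξ : ℝ) : ℂ) * Complex.I) * (f x : ℂ) := by
  rw [ballFourier, Real.fourier_eq', ← integral_indicator Metric.isClosed_closedBall.measurableSet]
  refine integral_congr_ae (Eventually.of_forall fun x => ?_)
  by_cases hx : x ∈ Metric.closedBall (0 : EuclideanSpace ℝ (Fin n)) N <;> simp [hx]

/-- On integrable functions the limit definition is the usual Fourier transform. -/
theorem radialFourier_eq_fourier {n : ℕ} (f : EuclideanSpace ℝ (Fin n) → ℝ)
    (hf : Integrable f) (ξ : EuclideanSpace ℝ (Fin n)) :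
    radialFourier f ξ = 𝓕 (fun x => (f x : ℂ)) ξ := by
  refine Tendsto.limUnder_eq ?_
  simp only [ballFourier, Real.fourier_eq']
  refine tendsto_integral_filter_of_dominated_convergence (fun x => ‖f x‖) ?_ ?_ hf.norm ?_
  · refine Eventually.of_forall fun N => ?_
    have hc : Continuous fun x : EuclideanSpace ℝ (Fin n) =>
        Complex.exp (((-2 * Real.pi * inner ℝ x ξ : ℝ) : ℂ) * Complex.I) := by fun_prop
    refine hc.aestronglyMeasurable.smul ?_
    exact hf.ofReal.aestronglyMeasurable.indicator Metric.isClosed_closedBall.measurableSet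
  · refine Eventually.of_forall fun N => Eventually.of_forall fun x => ?_
    rw [norm_smul, Complex.norm_exp_ofReal_mul_I, one_mul]
    exact (norm_indicator_le_norm_self _ _).trans (by simp)
  · refine Eventually.of_forall fun x => ?_
    refine tendsto_const_nhds.congr' ?_
    filter_upwards [eventually_ge_atTop ‖x‖] with N hN
    rw [indicator_of_mem (by simpa using hN)]

/-!
The proof rests on one pointwise bound: for a radial `f` with profile `f₀` as in the theorem,
`|f̂(ξ)| ≤ C ∫_0^{1/(2π|ξ|)} f₀(r) r^(n-1) dr`.
Given this bound, both sides of Pitt's inequality are one-dimensional integrals in polar coordinates,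
and the inequality becomes Hardy's inequality with a power weight (`lintegral_hardy_rpow`). The
condition `γ < n (1 - 1 / p)` is exactly the positivity of the exponent `β = n p - n - γ p` which
Hardy's inequality needs. When the right-hand side is finite, Hardy's inequality also shows that
`f₀(r) r^(n-1)` is integrable near the origin, so `f` is locally integrable.

For the pointwise bound write `g(r) = f₀(r) r^k` with `k = (n - 1) / 2`. In polar coordinates the
truncated transform at `ξ` is `∫_0^N g(r) r^k W(2π|ξ|r) dr`, where `W` is the Fourier transform of
the surface measure of the unit sphere along a fixed direction (`sphereWave`). The part over
`r ≤ 1/(2π|ξ|)` is estimated trivially. On the rest, `g` is non-increasing and `r^k W(r)` has bounded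
primitives on `[1, ∞)`, so the second mean value theorem (`norm_integral_antitone_mul_le`) gives both
convergence as `N → ∞` and a bound by a multiple of `g(T) T^(k+1)` with `T = 1/(2π|ξ|)`, which
monotonicity of `g` turns into the integral over `r ≤ T`.

No asymptotics of Bessel functions are needed for the bounded primitives. The function
`y(r) = r^k W(r)` solves `y'' = (c / r² - 1) y` with `c = k (k - 1)`; an energy estimate bounds `y` and
`y'` on `[1, ∞)`, and integrating `y = c y / r² - y''` bounds the primitive
(`norm_integral_le_of_bessel`). The differential equation itself (`sphereWave_relation`) follows by
integrating over `ℝⁿ` the directional derivative of a Gaussian-type radial factor times a function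
that is homogeneous of degree `0`, and separating the radial and angular integrals.
-/

/-! ### Integration in polar coordinates -/

section Polar

variable {E : Type*} [NormedAddCommGroup E] [NormedSpace ℝ E] [MeasurableSpace E] [BorelSpace E]
  [FiniteDimensional ℝ E] (μ : Measure E) [μ.IsAddHaarMeasure]
  {G : Type*} [NormedAddCommGroup G] [NormedSpace ℝ G]

theorem integral_volumeIoiPow (k : ℕ) (f : ℝ → G) :
    ∫ r : Ioi (0 : ℝ), f r ∂(Measure.volumeIoiPow k) = ∫ r in Ioi (0 : ℝ), r ^ k • f r := by
  simp only [Measure.volumeIoiPow, ENNReal.ofReal]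
  rw [integral_withDensity_eq_integral_smul,
    integral_subtype_comap measurableSet_Ioi fun a ↦ Real.toNNReal (a ^ k) • f a,
    setIntegral_congr_fun measurableSet_Ioi fun x hx ↦ ?_]
  · rw [NNReal.smul_def, Real.coe_toNNReal _ (pow_nonneg hx.out.le _)]
  · exact (measurable_subtype_coe.pow_const _).real_toNNReal

theorem lintegral_volumeIoiPow (k : ℕ) {f : ℝ → ℝ≥0∞} (hf : Measurable f) :
    ∫⁻ r : Ioi (0 : ℝ), f r ∂(Measure.volumeIoiPow k) =
      ∫⁻ r in Ioi (0 : ℝ), ENNReal.ofReal (r ^ k) * f r := by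
  rw [Measure.volumeIoiPow, lintegral_withDensity_eq_lintegral_mul _ (by fun_prop) (by fun_prop)]
  exact lintegral_subtype_comap measurableSet_Ioi (fun r : ℝ => ENNReal.ofReal (r ^ k) * f r)

/-- The Bochner integral in polar coordinates. -/
theorem integral_eq_integral_Ioi_toSphere [Nontrivial E] {F : E → G} (hF : Integrable F μ) :
    ∫ x, F x ∂μ = ∫ r in Ioi (0 : ℝ), r ^ (Module.finrank ℝ E - 1) •
      ∫ ω : Metric.sphere (0 : E) 1, F (r • (ω : E)) ∂μ.toSphere := by
  have hmp := (μ.measurePreserving_homeomorphUnitSphereProd).symm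
    (homeomorphUnitSphereProd E).toMeasurableEquiv
  have hcomap : Integrable (fun x : ({(0)}ᶜ : Set E) => F x) (μ.comap (↑)) := by
    have := (integrableOn_iff_comap_subtypeVal (μ := μ) (f := F)
      (s := ({(0)}ᶜ : Set E)) (by measurability)).1 hF.integrableOn
    exact this
  have hprod := (hmp.integrable_comp_emb
    (homeomorphUnitSphereProd E).toMeasurableEquiv.symm.measurableEmbedding).2 hcomap
  have h1 : ∫ x, F x ∂μ = ∫ x : ({(0)}ᶜ : Set E), F x ∂(μ.comap (↑)) := by
    rw [integral_subtype_comap (measurableSet_singleton _).compl F, restrict_compl_singleton]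
  rw [h1, ← hmp.integral_comp
    (homeomorphUnitSphereProd E).toMeasurableEquiv.symm.measurableEmbedding,
    ← integral_volumeIoiPow (Module.finrank ℝ E - 1)
      (fun r => ∫ ω : Metric.sphere (0 : E) 1, F (r • (ω : E)) ∂μ.toSphere)]
  exact integral_prod_symm _ hprod

theorem lintegral_fun_norm_eq [Nontrivial E] {F : ℝ → ℝ≥0∞} (hF : Measurable F) :
    ∫⁻ x, F ‖x‖ ∂μ = μ.toSphere univ * ∫⁻ r in Ioi (0 : ℝ),
      ENNReal.ofReal (r ^ (Module.finrank ℝ E - 1)) * F r := by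
  have hmp := μ.measurePreserving_homeomorphUnitSphereProd
  have h1 : ∫⁻ x, F ‖x‖ ∂μ = ∫⁻ x : ({(0)}ᶜ : Set E), F ‖(x : E)‖ ∂(μ.comap (↑)) := by
    rw [lintegral_subtype_comap (measurableSet_singleton _).compl (fun x : E => F ‖x‖),
      restrict_compl_singleton]
  have h2 := hmp.lintegral_comp (f := fun q => F q.2) (by fun_prop)
  simp only [homeomorphUnitSphereProd_apply_snd_coe] at h2
  rw [h1, h2, lintegral_prod _ (by fun_prop)]
  simp only [lintegral_const]
  rw [lintegral_volumeIoiPow _ hF, mul_comm]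

/-- The integral of a product of a radial and an angular function. -/
theorem integral_radial_mul_angular [Nontrivial E] {a : ℝ → ℂ} {b : E → ℂ}
    (h : Integrable (fun x => a ‖x‖ * b (‖x‖⁻¹ • x)) μ) :
    ∫ x, a ‖x‖ * b (‖x‖⁻¹ • x) ∂μ =
      (∫ r in Ioi (0 : ℝ), r ^ (Module.finrank ℝ E - 1) • a r) *
        ∫ ω : Metric.sphere (0 : E) 1, b ω ∂μ.toSphere := by
  rw [integral_eq_integral_Ioi_toSphere μ h, ← integral_mul_const]
  refine setIntegral_congr_fun measurableSet_Ioi fun r hr => ?_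
  have hr : (0 : ℝ) < r := hr
  have : ∀ ω : Metric.sphere (0 : E) 1,
      a ‖r • (ω : E)‖ * b (‖r • (ω : E)‖⁻¹ • (r • (ω : E))) = a r * b ω := by
    intro ω
    have : ‖r • (ω : E)‖ = r := by simp [norm_smul, abs_of_pos hr]
    rw [this, smul_smul, inv_mul_cancel₀ hr.ne', one_smul]
  simp only [this]
  rw [integral_const_mul, smul_mul_assoc]

end Polar

/-! ### Gaussian moments on the half-line -/

theorem integrableOn_pow_mul_exp_neg_sq (m : ℕ) :
    IntegrableOn (fun r : ℝ => r ^ m * Real.exp (-r ^ 2)) (Ioi 0) := by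
  have h := (integrable_rpow_mul_exp_neg_mul_sq one_pos (s := (m : ℝ))
    (by have := m.cast_nonneg (α := ℝ); linarith)).integrableOn (s := Ioi 0)
  refine h.congr_fun (fun r _ => ?_) measurableSet_Ioi
  simp [Real.rpow_natCast]

theorem integral_pow_mul_exp_neg_sq (m : ℕ) :
    ∫ r in Ioi (0 : ℝ), r ^ m * Real.exp (-r ^ 2) = 1 / 2 * Real.Gamma ((m + 1) / 2) := by
  rw [← integral_rpow_mul_exp_neg_rpow two_pos
    (by have := m.cast_nonneg (α := ℝ); linarith : (-1 : ℝ) < m)]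
  refine setIntegral_congr_fun measurableSet_Ioi fun r _ => ?_
  simp [Real.rpow_natCast]

theorem two_mul_integral_pow_add_two_mul_exp_neg_sq (m : ℕ) :
    2 * ∫ r in Ioi (0 : ℝ), r ^ (m + 2) * Real.exp (-r ^ 2) =
      (m + 1) * ∫ r in Ioi (0 : ℝ), r ^ m * Real.exp (-r ^ 2) := by
  rw [integral_pow_mul_exp_neg_sq, integral_pow_mul_exp_neg_sq,
    show (((m + 2 : ℕ) : ℝ) + 1) / 2 = ((m : ℝ) + 1) / 2 + 1 by push_cast; ring,
    Real.Gamma_add_one (by positivity)]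
  ring

/-! ### Plane waves averaged over the unit sphere -/

section SphereWave

variable {E : Type*} [NormedAddCommGroup E] [InnerProductSpace ℝ E]

theorem abs_inner_sphere_le {θ : E} (hθ : ‖θ‖ = 1) (ω : Metric.sphere (0 : E) 1) :
    |inner ℝ (ω : E) θ| ≤ 1 := by
  have := abs_real_inner_le_norm (ω : E) θ
  simpa [hθ] using this

theorem norm_sphereWave_integrand_le {θ : E} (hθ : ‖θ‖ = 1) (k : ℕ) (r : ℝ)
    (ω : Metric.sphere (0 : E) 1) :
    ‖((inner ℝ (ω : E) θ : ℝ) : ℂ) ^ k *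
      Complex.exp (((-(r * inner ℝ (ω : E) θ) : ℝ) : ℂ) * Complex.I)‖ ≤ 1 := by
  rw [norm_mul, Complex.norm_exp_ofReal_mul_I, mul_one, norm_pow, Complex.norm_real,
    Real.norm_eq_abs]
  exact pow_le_one₀ (abs_nonneg _) (abs_inner_sphere_le hθ ω)

theorem abs_inner_normalize_le {θ : E} (hθ : ‖θ‖ = 1) (x : E) :
    |inner ℝ (‖x‖⁻¹ • x) θ| ≤ 1 := by
  refine (abs_real_inner_le_norm _ _).trans ?_
  rw [hθ, mul_one, norm_smul, norm_inv, norm_norm]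
  exact inv_mul_le_one

theorem hasDerivAt_norm_add_smul (θ : E) {x : E} (hx : x ≠ 0) :
    HasDerivAt (fun s : ℝ => ‖x + s • θ‖) (inner ℝ x θ / ‖x‖) 0 := by
  have h1 : HasDerivAt (fun s : ℝ => x + s • θ) θ 0 := by
    simpa using ((hasDerivAt_id (0 : ℝ)).smul_const θ).const_add x
  have h2 := h1.norm_sq.sqrt (by simpa using hx)
  simp only [Real.sqrt_sq (norm_nonneg _)] at h2
  refine h2.congr_deriv ?_
  simp
  ring

/-- The derivative in direction `θ` of `‖x‖ ^ 2 * exp (-‖x‖ ^ 2) * exp (-i r ⟪x / ‖x‖, θ⟫)`, a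
radial function times a function homogeneous of degree `0`. The radial factor vanishes to second
order at the origin, so the derivative exists there too. -/
theorem hasLineDerivAt_gaussian_mul_homogeneous {θ : E} (hθ : ‖θ‖ = 1) (r : ℝ) (x : E) :
    HasLineDerivAt ℝ (fun x : E => ((‖x‖ ^ 2 * Real.exp (-‖x‖ ^ 2) : ℝ) : ℂ) *
        Complex.exp (((-(r * inner ℝ (‖x‖⁻¹ • x) θ) : ℝ) : ℂ) * Complex.I))
      (((2 * ‖x‖ - 2 * ‖x‖ ^ 3) * Real.exp (-‖x‖ ^ 2) : ℝ) *
        (((inner ℝ (‖x‖⁻¹ • x) θ : ℝ) : ℂ) *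
          Complex.exp (((-(r * inner ℝ (‖x‖⁻¹ • x) θ) : ℝ) : ℂ) * Complex.I)) +
        ((‖x‖ * Real.exp (-‖x‖ ^ 2) : ℝ) : ℂ) *
        (-Complex.I * r * ((1 - ((inner ℝ (‖x‖⁻¹ • x) θ : ℝ) : ℂ) ^ 2) *
          Complex.exp (((-(r * inner ℝ (‖x‖⁻¹ • x) θ) : ℝ) : ℂ) * Complex.I)))) x θ := by
  rcases eq_or_ne x 0 with rfl | hx
  · have hO : (fun s : ℝ => ((‖(0 : E) + s • θ‖ ^ 2 * Real.exp (-‖(0 : E) + s • θ‖ ^ 2) : ℝ) : ℂ) *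
        Complex.exp (((-(r * inner ℝ (‖(0 : E) + s • θ‖⁻¹ • ((0 : E) + s • θ)) θ) : ℝ) : ℂ) *
          Complex.I)) =O[𝓝 0] fun s : ℝ => ‖s - 0‖ ^ 2 := by
      refine Asymptotics.IsBigO.of_bound 1 (Eventually.of_forall fun s => ?_)
      rw [norm_mul, Complex.norm_exp_ofReal_mul_I, mul_one, Complex.norm_real]
      simp only [zero_add, norm_smul, hθ, mul_one, sub_zero, one_mul, norm_mul, norm_pow,
        Real.norm_eq_abs, abs_abs, Real.abs_exp]
      refine mul_le_of_le_one_right (by positivity) ?_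
      rw [Real.exp_le_one_iff]
      have := sq_nonneg |s|
      linarith
    have := (hO.hasFDerivAt one_lt_two).hasDerivAt
    rw [HasLineDerivAt]
    refine this.congr_deriv ?_
    simp
  · have hx0 : ‖x‖ ≠ 0 := norm_ne_zero_iff.2 hx
    have hN := hasDerivAt_norm_add_smul θ hx
    have hp : HasDerivAt (fun s : ℝ => inner ℝ (x + s • θ) θ) 1 0 := by
      have : (fun s : ℝ => inner ℝ (x + s • θ) θ) = fun s => inner ℝ x θ + s := by
        ext s
        rw [inner_add_left, real_inner_smul_left, real_inner_self_eq_norm_sq, hθ]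
        ring
      rw [this]
      exact (hasDerivAt_id (0 : ℝ)).const_add _
    have ht := (hN.inv (by simpa using hx0)).mul hp
    have hA := (hN.pow 2).mul ((hN.pow 2).neg.exp)
    have hE := ((ht.const_mul r).neg.ofReal_comp.mul_const Complex.I).cexp
    have hF := hA.ofReal_comp.mul hE
    have hfun : (fun s : ℝ => ((‖x + s • θ‖ ^ 2 * Real.exp (-‖x + s • θ‖ ^ 2) : ℝ) : ℂ) *
        Complex.exp (((-(r * inner ℝ (‖x + s • θ‖⁻¹ • (x + s • θ)) θ) : ℝ) : ℂ) * Complex.I)) =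
        fun s : ℝ => ((‖x + s • θ‖ ^ 2 * Real.exp (-‖x + s • θ‖ ^ 2) : ℝ) : ℂ) *
        Complex.exp (((-(r * (‖x + s • θ‖⁻¹ * inner ℝ (x + s • θ) θ)) : ℝ) : ℂ) * Complex.I) := by
      ext s
      rw [real_inner_smul_left]
    rw [HasLineDerivAt, hfun]
    refine hF.congr_deriv ?_
    simp only [real_inner_smul_left, zero_smul, add_zero, Pi.pow_apply, Pi.inv_apply, Pi.mul_apply,
      Pi.neg_apply]
    have hx0' : (‖x‖ : ℂ) ≠ 0 := by exact_mod_cast hx0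
    push_cast
    field_simp
    ring

variable [MeasurableSpace E] [BorelSpace E] [FiniteDimensional ℝ E]

/-- The integral of `⟪ω, θ⟫ ^ k * exp (-i r ⟪ω, θ⟫)` over the unit sphere. For `k = 0` it is, as a
function of `r`, the Fourier transform of the surface measure along the direction `θ`; the other
values of `k` give, up to powers of `-i`, its derivatives. -/
noncomputable def sphereWave (θ : E) (k : ℕ) (r : ℝ) : ℂ :=
  ∫ ω : Metric.sphere (0 : E) 1, ((inner ℝ (ω : E) θ : ℝ) : ℂ) ^ k *
    Complex.exp (((-(r * inner ℝ (ω : E) θ) : ℝ) : ℂ) * Complex.I) ∂(volume : Measure E).toSphere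

theorem integrable_sphereWave_integrand {θ : E} (hθ : ‖θ‖ = 1) (k : ℕ) (r : ℝ) :
    Integrable (fun ω : Metric.sphere (0 : E) 1 => ((inner ℝ (ω : E) θ : ℝ) : ℂ) ^ k *
      Complex.exp (((-(r * inner ℝ (ω : E) θ) : ℝ) : ℂ) * Complex.I))
      (volume : Measure E).toSphere :=
  Integrable.of_bound (Continuous.aestronglyMeasurable (by fun_prop)) 1
    (Eventually.of_forall (norm_sphereWave_integrand_le hθ k r))

theorem norm_sphereWave_le {θ : E} (hθ : ‖θ‖ = 1) (k : ℕ) (r : ℝ) :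
    ‖sphereWave θ k r‖ ≤ (volume : Measure E).toSphere.real univ := by
  have := norm_integral_le_of_norm_le_const (μ := (volume : Measure E).toSphere)
    (Eventually.of_forall (norm_sphereWave_integrand_le hθ k r))
  simpa [sphereWave] using this

theorem hasDerivAt_sphereWave {θ : E} (hθ : ‖θ‖ = 1) (k : ℕ) (r : ℝ) :
    HasDerivAt (sphereWave θ k) (-Complex.I * sphereWave θ (k + 1) r) r := by
  have h := hasDerivAt_integral_of_dominated_loc_of_deriv_le
    (μ := (volume : Measure E).toSphere) (s := univ) (x₀ := r) (bound := fun _ => 1)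
    (F := fun (r : ℝ) (ω : Metric.sphere (0 : E) 1) => ((inner ℝ (ω : E) θ : ℝ) : ℂ) ^ k *
      Complex.exp (((-(r * inner ℝ (ω : E) θ) : ℝ) : ℂ) * Complex.I))
    (F' := fun (r : ℝ) (ω : Metric.sphere (0 : E) 1) =>
      -Complex.I * (((inner ℝ (ω : E) θ : ℝ) : ℂ) ^ (k + 1) *
      Complex.exp (((-(r * inner ℝ (ω : E) θ) : ℝ) : ℂ) * Complex.I)))
    univ_mem
    (Eventually.of_forall fun r => Continuous.aestronglyMeasurable (by fun_prop))
    (integrable_sphereWave_integrand hθ k r)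
    (Continuous.aestronglyMeasurable (by fun_prop))
    (Eventually.of_forall fun ω s _ => ?_) (integrable_const _)
    (Eventually.of_forall fun ω s _ => ?_)
  · have h2 := h.2
    rw [integral_const_mul] at h2
    exact h2
  · rw [norm_mul, norm_neg, Complex.norm_I, one_mul]
    exact norm_sphereWave_integrand_le hθ _ _ _
  · have h1 : HasDerivAt (fun s : ℝ => -(s * inner ℝ (ω : E) θ)) (-(inner ℝ (ω : E) θ)) s :=
        (hasDerivAt_mul_const (inner ℝ (ω : E) θ)).neg
    have h2 := ((h1.ofReal_comp.mul_const Complex.I).cexp).const_mul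
      (((inner ℝ (ω : E) θ : ℝ) : ℂ) ^ k)
    refine h2.congr_deriv ?_
    push_cast
    ring

theorem measurable_inner_normalize (θ : E) :
    Measurable fun x : E => inner ℝ (‖x‖⁻¹ • x) θ := by
  fun_prop

theorem integrable_radial_pow_mul_exp [Nontrivial E] (m : ℕ) :
    Integrable (fun x : E => ((‖x‖ ^ m * Real.exp (-‖x‖ ^ 2) : ℝ) : ℂ)) := by
  refine Integrable.ofReal ?_
  refine (integrable_fun_norm_addHaar volume
    (f := fun r : ℝ => r ^ m * Real.exp (-r ^ 2))).2 ?_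
  refine (integrableOn_pow_mul_exp_neg_sq (Module.finrank ℝ E - 1 + m)).congr_fun
    (fun r _ => ?_) measurableSet_Ioi
  simp only [smul_eq_mul, pow_add]
  ring

/-- The sphere averages of plane waves satisfy Bessel's equation, here written as a linear relation
between the first three of them. It is the divergence theorem for the tangential part of `θ`,
obtained by integrating a directional derivative over the whole space. -/
theorem sphereWave_relation [Nontrivial E] {θ : E} (hθ : ‖θ‖ = 1) (r : ℝ) :
    ((Module.finrank ℝ E : ℂ) - 1) * sphereWave θ 1 r =
      -Complex.I * r * (sphereWave θ 0 r - sphereWave θ 2 r) := by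
  set d := Module.finrank ℝ E with hd
  have hdpos : 0 < d := Module.finrank_pos
  set e : E → ℂ := fun y => Complex.exp (((-(r * inner ℝ y θ) : ℝ) : ℂ) * Complex.I) with he
  have hem : Measurable fun x : E => e (‖x‖⁻¹ • x) := by
    have := measurable_inner_normalize θ
    simp only [he]
    fun_prop
  have henorm : ∀ y, ‖e y‖ = 1 := fun y => Complex.norm_exp_ofReal_mul_I _
  have ht := measurable_inner_normalize θ
  have ht1 := fun x : E => abs_inner_normalize_le hθ x
  set Φ : E → ℂ := fun x => ((‖x‖ ^ 2 * Real.exp (-‖x‖ ^ 2) : ℝ) : ℂ) * e (‖x‖⁻¹ • x) with hΦ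
  have hΦint : Integrable Φ :=
    (integrable_radial_pow_mul_exp 2).mul_bdd (c := 1) hem.aestronglyMeasurable
      (Eventually.of_forall fun x => (henorm _).le)
  set b₁ : E → ℂ := fun y => ((inner ℝ y θ : ℝ) : ℂ) * e y with hb₁
  set b₂ : E → ℂ := fun y => -Complex.I * r * ((1 - ((inner ℝ y θ : ℝ) : ℂ) ^ 2) * e y) with hb₂
  set a₁ : ℝ → ℂ := fun u => (((2 * u - 2 * u ^ 3) * Real.exp (-u ^ 2) : ℝ) : ℂ) with ha₁
  set a₂ : ℝ → ℂ := fun u => ((u * Real.exp (-u ^ 2) : ℝ) : ℂ) with ha₂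
  have h₁ : Integrable fun x : E => a₁ ‖x‖ * b₁ (‖x‖⁻¹ • x) := by
    have hi : Integrable fun x : E => a₁ ‖x‖ := by
      refine (((integrable_radial_pow_mul_exp (E := E) 1).const_mul 2).sub
        ((integrable_radial_pow_mul_exp (E := E) 3).const_mul 2)).congr
        (Eventually.of_forall fun x => ?_)
      simp only [ha₁, Pi.sub_apply]
      push_cast
      ring
    refine hi.mul_bdd (c := 1) ?_ (Eventually.of_forall fun x => ?_)
    · exact (ht.complex_ofReal.mul hem).aestronglyMeasurable
    · rw [norm_mul, henorm, mul_one, Complex.norm_real]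
      exact ht1 x
  have h₂ : Integrable fun x : E => a₂ ‖x‖ * b₂ (‖x‖⁻¹ • x) := by
    have hi : Integrable fun x : E => a₂ ‖x‖ := by
      refine (integrable_radial_pow_mul_exp (E := E) 1).congr
        (Eventually.of_forall fun x => ?_)
      simp only [ha₂, pow_one]
    refine hi.mul_bdd (c := |r|) ?_ (Eventually.of_forall fun x => ?_)
    · exact ((((ht.complex_ofReal.pow_const 2).const_sub 1).mul hem).const_mul
        _).aestronglyMeasurable
    · rw [norm_mul, norm_mul, norm_mul, henorm, mul_one, norm_neg, Complex.norm_I, one_mul,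
        Complex.norm_real, Real.norm_eq_abs]
      refine mul_le_of_le_one_right (abs_nonneg r) ?_
      rw [← Complex.ofReal_pow, ← Complex.ofReal_one, ← Complex.ofReal_sub, Complex.norm_real,
        Real.norm_eq_abs, abs_le]
      have := sq_le_one_iff_abs_le_one _ |>.2 (ht1 x)
      constructor <;> nlinarith [sq_nonneg (inner ℝ (‖x‖⁻¹ • x) θ)]
  have h₁₂ : Integrable fun x : E => a₁ ‖x‖ * b₁ (‖x‖⁻¹ • x) + a₂ ‖x‖ * b₂ (‖x‖⁻¹ • x) :=
    h₁.add h₂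
  -- A directional derivative of an integrable function has integral zero.
  have hzero : ∫ x : E, (a₁ ‖x‖ * b₁ (‖x‖⁻¹ • x) + a₂ ‖x‖ * b₂ (‖x‖⁻¹ • x)) = 0 := by
    have := integral_bilinear_hasLineDerivAt_right_eq_neg_left_of_integrable
      (μ := (volume : Measure E)) (f := fun _ : E => (1 : ℂ)) (f' := fun _ => 0) (g := Φ)
      (g' := fun x => a₁ ‖x‖ * b₁ (‖x‖⁻¹ • x) + a₂ ‖x‖ * b₂ (‖x‖⁻¹ • x)) (v := θ)
      (B := ContinuousLinearMap.mul ℝ ℂ) (by simp) (by simpa using h₁₂)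
      (by simpa using hΦint) (fun x _ => hasDerivAt_const ..)
      (fun x _ => hasLineDerivAt_gaussian_mul_homogeneous hθ r x)
    simpa using this
  rw [integral_add h₁ h₂, integral_radial_mul_angular volume h₁,
    integral_radial_mul_angular volume h₂] at hzero
  set G : ℝ := ∫ u in Ioi (0 : ℝ), u ^ d * Real.exp (-u ^ 2) with hG
  have hGpos : 0 < G := by
    rw [hG, integral_pow_mul_exp_neg_sq]
    have := Real.Gamma_pos_of_pos (s := ((d : ℝ) + 1) / 2) (by positivity)
    positivity
  have hA₁ : ∫ u in Ioi (0 : ℝ), u ^ (d - 1) • a₁ u = ((-(d - 1) * G : ℝ) : ℂ) := by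
    have hG2 := two_mul_integral_pow_add_two_mul_exp_neg_sq d
    have : -((d : ℝ) - 1) * G = ∫ u in Ioi (0 : ℝ),
        (2 * (u ^ d * Real.exp (-u ^ 2)) - 2 * (u ^ (d + 2) * Real.exp (-u ^ 2))) := by
      rw [integral_sub ((integrableOn_pow_mul_exp_neg_sq d).const_mul 2)
        ((integrableOn_pow_mul_exp_neg_sq (d + 2)).const_mul 2), integral_const_mul,
        integral_const_mul, hG2]
      ring
    rw [this, ← integral_complex_ofReal]
    refine setIntegral_congr_fun measurableSet_Ioi fun u _ => ?_
    obtain ⟨k, hk⟩ : ∃ k, d = k + 1 := ⟨d - 1, by omega⟩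
    simp only [ha₁, hk, Complex.real_smul, Nat.add_sub_cancel]
    push_cast
    ring
  have hA₂ : ∫ u in Ioi (0 : ℝ), u ^ (d - 1) • a₂ u = (G : ℂ) := by
    rw [hG, ← integral_complex_ofReal]
    refine setIntegral_congr_fun measurableSet_Ioi fun u _ => ?_
    obtain ⟨k, hk⟩ : ∃ k, d = k + 1 := ⟨d - 1, by omega⟩
    simp only [ha₂, hk, Complex.real_smul, Nat.add_sub_cancel]
    push_cast
    ring
  have hB₁ : ∫ ω : Metric.sphere (0 : E) 1, b₁ ω ∂(volume : Measure E).toSphere =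
      sphereWave θ 1 r := by
    simp only [hb₁, he, sphereWave, pow_one]
  have hB₂ : ∫ ω : Metric.sphere (0 : E) 1, b₂ ω ∂(volume : Measure E).toSphere =
      -Complex.I * r * (sphereWave θ 0 r - sphereWave θ 2 r) := by
    simp only [hb₂, he, sphereWave]
    rw [integral_const_mul, ← integral_sub (integrable_sphereWave_integrand hθ 0 r)
      (integrable_sphereWave_integrand hθ 2 r)]
    congr 2
    ext ω
    ring
  rw [hA₁, hA₂, hB₁, hB₂] at hzero
  have hG0 : (G : ℂ) ≠ 0 := by exact_mod_cast hGpos.ne'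
  refine mul_left_cancel₀ hG0 ?_
  push_cast at hzero
  linear_combination -hzero

end SphereWave

/-! ### Bounded primitives of solutions of Bessel's equation -/

/-- Energy estimate: the solutions of `y'' = (c / r ^ 2 - 1) y` are bounded on `[1, ∞)` together with
their derivative, because `(‖y‖ ^ 2 + ‖y'‖ ^ 2) * exp (|c| / r)` is non-increasing. -/
theorem sq_norm_add_sq_norm_deriv_le {c : ℝ} {y y' : ℝ → ℂ}
    (hy : ∀ r, 0 < r → HasDerivAt y (y' r) r)
    (hy' : ∀ r, 0 < r → HasDerivAt y' (((c / r ^ 2 - 1 : ℝ) : ℂ) * y r) r)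
    {r : ℝ} (hr : 1 ≤ r) :
    ‖y r‖ ^ 2 + ‖y' r‖ ^ 2 ≤ (‖y 1‖ ^ 2 + ‖y' 1‖ ^ 2) * Real.exp |c| := by
  set F : ℝ → ℝ := fun r => (‖y r‖ ^ 2 + ‖y' r‖ ^ 2) * Real.exp (|c| * r⁻¹) with hF
  have hder : ∀ r, 0 < r → HasDerivAt F
      ((2 * inner ℝ (y r) (y' r) + 2 * inner ℝ (y' r) (((c / r ^ 2 - 1 : ℝ) : ℂ) * y r)) *
        Real.exp (|c| * r⁻¹) + (‖y r‖ ^ 2 + ‖y' r‖ ^ 2) *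
        (Real.exp (|c| * r⁻¹) * (|c| * -(r ^ 2)⁻¹))) r := fun r hr =>
    ((hy r hr).norm_sq.add (hy' r hr).norm_sq).mul
      ((hasDerivAt_inv hr.ne').const_mul |c|).exp
  have hanti : AntitoneOn F (Ici 1) := by
    refine antitoneOn_of_hasDerivWithinAt_nonpos (convex_Ici 1)
      (fun r hr => (hder r (one_pos.trans_le hr)).continuousAt.continuousWithinAt)
      (fun r hr => (hder r ?_).hasDerivWithinAt) (fun r hr => ?_)
    · rw [interior_Ici] at hr
      exact one_pos.trans hr
    · rw [interior_Ici] at hr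
      have hr0 : 0 < r := one_pos.trans hr
      have h1 : inner ℝ (y' r) (((c / r ^ 2 - 1 : ℝ) : ℂ) * y r) =
          (c / r ^ 2 - 1) * inner ℝ (y r) (y' r) := by
        rw [← Complex.real_smul, real_inner_smul_right, real_inner_comm]
      have h2 : |inner ℝ (y r) (y' r)| ≤ ‖y r‖ * ‖y' r‖ := abs_real_inner_le_norm _ _
      have h3 : c * (2 * inner ℝ (y r) (y' r)) ≤ |c| * (‖y r‖ ^ 2 + ‖y' r‖ ^ 2) := by
        refine (le_abs_self _).trans ?_
        rw [abs_mul, abs_mul, abs_two]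
        refine mul_le_mul_of_nonneg_left ?_ (abs_nonneg c)
        nlinarith [sq_nonneg (‖y r‖ - ‖y' r‖)]
      rw [h1]
      have h4 : (2 * inner ℝ (y r) (y' r) + 2 * ((c / r ^ 2 - 1) * inner ℝ (y r) (y' r))) *
          Real.exp (|c| * r⁻¹) + (‖y r‖ ^ 2 + ‖y' r‖ ^ 2) *
          (Real.exp (|c| * r⁻¹) * (|c| * -(r ^ 2)⁻¹)) =
          (c * (2 * inner ℝ (y r) (y' r)) - |c| * (‖y r‖ ^ 2 + ‖y' r‖ ^ 2)) *
          (Real.exp (|c| * r⁻¹) * (r ^ 2)⁻¹) := by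
        field_simp
        ring
      rw [h4]
      exact mul_nonpos_of_nonpos_of_nonneg (by linarith) (by positivity)
  have h := hanti (self_mem_Ici) (mem_Ici.2 hr) hr
  simp only [hF, inv_one, mul_one] at h
  refine le_trans ?_ h
  refine le_mul_of_one_le_right (by positivity) (Real.one_le_exp ?_)
  have : 0 < r := one_pos.trans_le hr
  positivity

/-- Solutions of `y'' = (c / r ^ 2 - 1) y` have bounded primitives on `[1, ∞)`, since
`y = c y / r ^ 2 - y''` and `y`, `y'` are bounded there. -/
theorem norm_integral_le_of_bessel {c A : ℝ} {y y' : ℝ → ℂ}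
    (hy : ∀ r, 0 < r → HasDerivAt y (y' r) r)
    (hy' : ∀ r, 0 < r → HasDerivAt y' (((c / r ^ 2 - 1 : ℝ) : ℂ) * y r) r)
    (h1 : ‖y 1‖ ≤ A) (h1' : ‖y' 1‖ ≤ A) {R : ℝ} (hR : 1 ≤ R) :
    ‖∫ r in (1 : ℝ)..R, y r‖ ≤ (2 + |c|) * √(2 * A ^ 2 * Real.exp |c|) := by
  set B := √(2 * A ^ 2 * Real.exp |c|) with hB
  have hE : ∀ r, 1 ≤ r → ‖y r‖ ^ 2 + ‖y' r‖ ^ 2 ≤ 2 * A ^ 2 * Real.exp |c| := fun r hr => by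
    refine (sq_norm_add_sq_norm_deriv_le hy hy' hr).trans ?_
    have : ‖y 1‖ ^ 2 ≤ A ^ 2 := pow_le_pow_left₀ (norm_nonneg _) h1 2
    have : ‖y' 1‖ ^ 2 ≤ A ^ 2 := pow_le_pow_left₀ (norm_nonneg _) h1' 2
    gcongr
    linarith
  have hyB : ∀ r, 1 ≤ r → ‖y r‖ ≤ B := fun r hr =>
    Real.le_sqrt_of_sq_le (by nlinarith [hE r hr, sq_nonneg ‖y' r‖])
  have hyB' : ∀ r, 1 ≤ r → ‖y' r‖ ≤ B := fun r hr =>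
    Real.le_sqrt_of_sq_le (by nlinarith [hE r hr, sq_nonneg ‖y r‖])
  have hpos : ∀ r ∈ uIcc 1 R, 0 < r := fun r hr => by
    rw [uIcc_of_le hR] at hr
    exact one_pos.trans_le hr.1
  have hyc : ContinuousOn y (uIcc 1 R) := fun r hr =>
    (hy r (hpos r hr)).continuousAt.continuousWithinAt
  have hq : ContinuousOn (fun r : ℝ => ((c / r ^ 2 : ℝ) : ℂ) * y r) (uIcc 1 R) := by
    refine ContinuousOn.mul (Complex.continuous_ofReal.comp_continuousOn ?_) hyc
    exact continuousOn_const.div (by fun_prop) fun r hr => (pow_pos (hpos r hr) 2).ne'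
  have hsub : ∫ r in (1 : ℝ)..R, (((c / r ^ 2 : ℝ) : ℂ) * y r - y r) = y' R - y' 1 := by
    refine intervalIntegral.integral_eq_sub_of_hasDerivAt (fun r hr => ?_)
      (hq.sub hyc).intervalIntegrable
    refine (hy' r (hpos r hr)).congr_deriv ?_
    push_cast
    ring
  rw [intervalIntegral.integral_sub hq.intervalIntegrable hyc.intervalIntegrable] at hsub
  have hBq : ‖∫ r in (1 : ℝ)..R, ((c / r ^ 2 : ℝ) : ℂ) * y r‖ ≤ |c| * B := by
    have hint : IntervalIntegrable (fun r : ℝ => |c| * B * (r ^ 2)⁻¹) volume 1 R := by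
      refine ContinuousOn.intervalIntegrable ?_
      exact continuousOn_const.mul ((continuousOn_pow 2).inv₀
        fun r hr => (pow_pos (hpos r hr) 2).ne')
    have hb := intervalIntegral.norm_integral_le_of_norm_le (μ := volume) hR
      (f := fun r : ℝ => ((c / r ^ 2 : ℝ) : ℂ) * y r) (g := fun r : ℝ => |c| * B * (r ^ 2)⁻¹)
      (Eventually.of_forall fun r hr => ?_) hint
    · refine hb.trans ?_
      have : ∫ r in (1 : ℝ)..R, (r ^ 2)⁻¹ = -R⁻¹ - -(1 : ℝ)⁻¹ := by
        refine intervalIntegral.integral_eq_sub_of_hasDerivAt (f := fun r : ℝ => -r⁻¹)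
          (fun r hr => ?_) ?_
        · exact (hasDerivAt_inv (hpos r hr).ne').neg.congr_deriv (neg_neg _)
        · exact ContinuousOn.intervalIntegrable ((continuousOn_pow 2).inv₀
            fun r hr => (pow_pos (hpos r hr) 2).ne')
      rw [intervalIntegral.integral_const_mul, this]
      refine mul_le_of_le_one_right (mul_nonneg (abs_nonneg c) (Real.sqrt_nonneg _)) ?_
      have : 0 < R⁻¹ := inv_pos.2 (one_pos.trans_le hR)
      simp only [inv_one]
      linarith
    · rw [norm_mul, Complex.norm_real, Real.norm_eq_abs, abs_div, abs_of_nonneg (sq_nonneg r),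
        div_eq_mul_inv, mul_right_comm]
      have := hyB r hr.1.le
      gcongr
  have hfin : ∫ r in (1 : ℝ)..R, y r =
      (∫ r in (1 : ℝ)..R, ((c / r ^ 2 : ℝ) : ℂ) * y r) - (y' R - y' 1) := by
    rw [← hsub]
    ring
  rw [hfin]
  refine (norm_sub_le _ _).trans ?_
  have := norm_sub_le (y' R) (y' 1)
  have := hyB' R hR
  have := hyB' 1 le_rfl
  linarith

section SphereWave

variable {E : Type*} [NormedAddCommGroup E] [InnerProductSpace ℝ E] [MeasurableSpace E]
  [BorelSpace E] [FiniteDimensional ℝ E]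

/-- With the factor `r ^ ((n - 1) / 2)`, the Fourier transform of the surface measure has bounded
primitives on `[1, ∞)`. -/
theorem exists_norm_integral_rpow_mul_sphereWave_le [Nontrivial E] {k : ℝ}
    (hk : 2 * k = (Module.finrank ℝ E : ℝ) - 1) :
    ∃ M : ℝ, 0 ≤ M ∧ ∀ θ : E, ‖θ‖ = 1 → ∀ R : ℝ, 1 ≤ R →
      ‖∫ r in (1 : ℝ)..R, ((r ^ k : ℝ) : ℂ) * sphereWave θ 0 r‖ ≤ M := by
  set V := (volume : Measure E).toSphere.real univ
  have hV : 0 ≤ V := measureReal_nonneg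
  refine ⟨_, ?_, fun θ hθ R hR => norm_integral_le_of_bessel (c := k * (k - 1))
    (A := |k| * V + V)
    (y' := fun r => ((k * r ^ (k - 1) : ℝ) : ℂ) * sphereWave θ 0 r +
      ((r ^ k : ℝ) : ℂ) * (-Complex.I * sphereWave θ 1 r))
    (fun r hr => ?_) (fun r hr => ?_) ?_ ?_ hR⟩
  · positivity
  · exact (Real.hasDerivAt_rpow_const (Or.inl hr.ne')).ofReal_comp.mul
      (hasDerivAt_sphereWave hθ 0 r)
  · have h0 := (Real.hasDerivAt_rpow_const (p := k) (Or.inl hr.ne')).ofReal_comp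
    have h1 := ((Real.hasDerivAt_rpow_const (p := k - 1) (Or.inl hr.ne')).const_mul k).ofReal_comp
    refine ((h1.mul (hasDerivAt_sphereWave hθ 0 r)).add
      (h0.mul ((hasDerivAt_sphereWave hθ 1 r).const_mul (-Complex.I)))).congr_deriv ?_
    have hrel := sphereWave_relation hθ r
    have hk' : (Module.finrank ℝ E : ℂ) - 1 = 2 * (k : ℂ) := by
      have : (((Module.finrank ℝ E : ℝ) - 1 : ℝ) : ℂ) = ((2 * k : ℝ) : ℂ) := by rw [hk]
      push_cast at this
      exact this
    rw [hk'] at hrel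
    have hr0 : (r : ℂ) ≠ 0 := by exact_mod_cast hr.ne'
    rw [Real.rpow_sub_one hr.ne', Real.rpow_sub_one hr.ne']
    push_cast
    field_simp
    have hI : Complex.I ^ 2 = -1 := Complex.I_sq
    linear_combination (-Complex.I * r * ((r ^ k : ℝ) : ℂ)) * hrel +
      (((r ^ k : ℝ) : ℂ) * r ^ 2 * sphereWave θ 0 r) * hI
  · simpa using (norm_sphereWave_le hθ 0 1).trans (by
      have : 0 ≤ |k| * V := by positivity
      linarith)
  · refine (norm_add_le _ _).trans (add_le_add ?_ ?_)
    · simp only [Real.one_rpow, mul_one, norm_mul, Complex.norm_real, Real.norm_eq_abs]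
      exact mul_le_mul_of_nonneg_left (norm_sphereWave_le hθ 0 1) (abs_nonneg k)
    · rw [Real.one_rpow, Complex.ofReal_one, one_mul, norm_mul, norm_neg, Complex.norm_I, one_mul]
      exact norm_sphereWave_le hθ 1 1

end SphereWave

/-! ### The second mean value theorem -/

theorem norm_setIntegral_superlevel_le {g : ℝ → ℝ} (hg : Antitone g) {k : ℝ → ℂ} {a b M : ℝ}
    (hab : a ≤ b) (hM : ∀ x ∈ Icc a b, ‖∫ r in a..x, k r‖ ≤ M) (l : ℝ) :
    ‖∫ r in Ioc a b, {r | l < g r}.indicator k r‖ ≤ M := by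
  -- The superlevel set meets `(a, b]` in an interval starting at `a`, up to its right endpoint.
  set S : Set ℝ := insert a {r ∈ Icc a b | l < g r} with hS
  have hSb : ∀ r ∈ S, r ≤ b := by
    rintro r (rfl | hr)
    exacts [hab, hr.1.2]
  have hbdd : BddAbove S := ⟨b, hSb⟩
  have hne : S.Nonempty := ⟨a, mem_insert _ _⟩
  set x := sSup S with hx
  have hax : a ≤ x := le_csSup hbdd (mem_insert _ _)
  have hxb : x ≤ b := csSup_le hne hSb
  have heq : ∫ r in Ioc a b, {r | l < g r}.indicator k r = ∫ r in a..x, k r := by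
    rw [intervalIntegral.integral_of_le hax, ← integral_indicator measurableSet_Ioc,
      ← integral_indicator measurableSet_Ioc]
    refine integral_congr_ae ?_
    have hae : ∀ᵐ r : ℝ, r ≠ x := by simp [ae_iff]
    filter_upwards [hae] with r hr
    by_cases hab' : r ∈ Ioc a b
    · rw [indicator_of_mem hab']
      rcases lt_or_gt_of_ne hr with h | h
      · obtain ⟨z, hz, hrz⟩ := exists_lt_of_lt_csSup hne h
        have hlz : l < g z := by
          rcases hz with rfl | hz
          · exact absurd hrz hab'.1.not_gt
          · exact hz.2
        rw [indicator_of_mem (show r ∈ {r | l < g r} from hlz.trans_le (hg hrz.le)),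
          indicator_of_mem (show r ∈ Ioc a x from ⟨hab'.1, h.le⟩)]
      · rw [indicator_of_notMem, indicator_of_notMem (fun h' : r ∈ Ioc a x => h.not_ge h'.2)]
        intro hl
        exact h.not_ge (le_csSup hbdd (mem_insert_of_mem _ ⟨Ioc_subset_Icc_self hab', hl⟩))
    · rw [indicator_of_notMem hab',
        indicator_of_notMem (fun h' : r ∈ Ioc a x => hab' ⟨h'.1, h'.2.trans hxb⟩)]
  rw [heq]
  exact hM x ⟨hax, hxb⟩

/-- **Second mean value theorem**, as an inequality: an integral against a non-increasing
non-negative weight is controlled by the primitives of the integrand. The weight is a superposition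
of indicators of its superlevel sets, which are intervals. -/
theorem norm_integral_antitone_mul_le {g : ℝ → ℝ} (hg : Antitone g) (hg0 : ∀ r, 0 ≤ g r)
    {k : ℝ → ℂ} {a b M : ℝ} (hab : a ≤ b) (hk : IntegrableOn k (Ioc a b))
    (hM : ∀ x ∈ Icc a b, ‖∫ r in a..x, k r‖ ≤ M) :
    ‖∫ r in a..b, (g r : ℂ) * k r‖ ≤ g a * M := by
  have hlayer : ∀ r ∈ Ioc a b, (g r : ℂ) * k r =
      ∫ l in Ioc 0 (g a), {r | l < g r}.indicator k r := by
    intro r hr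
    have h1 : (fun l : ℝ => {r | l < g r}.indicator k r) =
        (Iio (g r)).indicator fun _ => k r := by
      ext l
      simp [indicator]
    rw [h1, setIntegral_indicator measurableSet_Iio]
    have h2 : Ioc 0 (g a) ∩ Iio (g r) = Ioo 0 (g r) := by
      ext l
      simp only [mem_inter_iff, mem_Ioc, mem_Iio, mem_Ioo]
      exact ⟨fun h => ⟨h.1.1, h.2⟩, fun h => ⟨⟨h.1, h.2.le.trans (hg hr.1.le)⟩, h.2⟩⟩
    rw [h2, setIntegral_const, Measure.real, Real.volume_Ioo, sub_zero,
      ENNReal.toReal_ofReal (hg0 r), Complex.real_smul]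
  rw [intervalIntegral.integral_of_le hab, setIntegral_congr_fun measurableSet_Ioc hlayer]
  have hmeas : MeasurableSet {q : ℝ × ℝ | q.2 < g q.1} :=
    measurableSet_lt measurable_snd (hg.measurable.comp measurable_fst)
  have hint : Integrable (Function.uncurry fun r l : ℝ => {r | l < g r}.indicator k r)
      ((volume.restrict (Ioc a b)).prod (volume.restrict (Ioc 0 (g a)))) := by
    have h1 : Integrable (fun q : ℝ × ℝ => k q.1)
        ((volume.restrict (Ioc a b)).prod (volume.restrict (Ioc 0 (g a)))) :=
      Integrable.comp_fst hk _
    refine (h1.indicator hmeas).congr (Eventually.of_forall fun q => ?_)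
    simp [indicator, Function.uncurry]
  rw [integral_integral_swap hint]
  have := norm_setIntegral_le_of_norm_le_const (μ := volume) (s := Ioc 0 (g a)) (C := M)
    (f := fun l : ℝ => ∫ r in Ioc a b, {r | l < g r}.indicator k r) (by simp)
    (fun l _ => norm_setIntegral_superlevel_le hg hab hM l)
  rwa [Measure.real, Real.volume_Ioc, sub_zero, ENNReal.toReal_ofReal (hg0 a), mul_comm] at this

/-! ### Hardy's inequality -/

theorem lintegral_Ioc_rpow_sub_one {δ T : ℝ} (hδ : 0 < δ) (hT : 0 ≤ T) :
    ∫⁻ s in Ioc 0 T, ENNReal.ofReal (s ^ (δ - 1)) = ENNReal.ofReal (T ^ δ / δ) := by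
  rw [← ofReal_integral_eq_lintegral_ofReal, ← intervalIntegral.integral_of_le hT,
    integral_rpow (Or.inl (by linarith))]
  · simp [Real.zero_rpow hδ.ne']
  · exact (intervalIntegral.intervalIntegrable_rpow' (by linarith)).1
  · filter_upwards [ae_restrict_mem measurableSet_Ioc] with s hs
    exact Real.rpow_nonneg hs.1.le _

/-- Hölder's inequality against the power weight `r ^ (ε - 1)`. -/
theorem lintegral_Ioc_rpow_le {p ε T : ℝ} (hp : 1 ≤ p) (hε : 0 < ε) (hT : 0 < T)
    {h : ℝ → ℝ≥0∞} (hh : Measurable h) :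
    (∫⁻ r in Ioc 0 T, h r) ^ p ≤ ENNReal.ofReal ((T ^ ε / ε) ^ (p - 1)) *
      ∫⁻ r in Ioc 0 T, h r ^ p * ENNReal.ofReal (r ^ ((1 - ε) * (p - 1))) := by
  have hp0 : 0 < p := by linarith
  have hq : 0 ≤ 1 - 1 / p := by
    rw [sub_nonneg, div_le_one hp0]
    exact hp
  have hH := ENNReal.lintegral_mul_norm_pow_le (μ := volume.restrict (Ioc 0 T))
    (f := fun r => h r ^ p * ENNReal.ofReal (r ^ ((1 - ε) * (p - 1))))
    (g := fun r => ENNReal.ofReal (r ^ (ε - 1)))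
    (by fun_prop) (by fun_prop) (p := 1 / p) (q := 1 - 1 / p) (by positivity) hq (by ring)
  have hcongr : ∫⁻ r in Ioc 0 T, h r = ∫⁻ r in Ioc 0 T,
      (h r ^ p * ENNReal.ofReal (r ^ ((1 - ε) * (p - 1)))) ^ (1 / p) *
        ENNReal.ofReal (r ^ (ε - 1)) ^ (1 - 1 / p) := by
    refine setLIntegral_congr_fun measurableSet_Ioc fun r hr => ?_
    have hr0 : 0 < r := hr.1
    have h1 : 0 < r ^ ((1 - ε) * (p - 1)) := Real.rpow_pos_of_pos hr0 _
    have h2 : 0 < r ^ (ε - 1) := Real.rpow_pos_of_pos hr0 _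
    rw [ENNReal.mul_rpow_of_nonneg _ _ (by positivity), ← ENNReal.rpow_mul,
      mul_one_div_cancel hp0.ne', ENNReal.rpow_one, mul_assoc, ENNReal.ofReal_rpow_of_pos h1,
      ENNReal.ofReal_rpow_of_pos h2, ← ENNReal.ofReal_mul (by positivity),
      ← Real.rpow_mul hr0.le, ← Real.rpow_mul hr0.le, ← Real.rpow_add hr0]
    have : (1 - ε) * (p - 1) * (1 / p) + (ε - 1) * (1 - 1 / p) = 0 := by
      field_simp
      ring
    rw [this, Real.rpow_zero, ENNReal.ofReal_one, mul_one]
  rw [hcongr]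
  refine (ENNReal.rpow_le_rpow hH hp0.le).trans (le_of_eq ?_)
  rw [ENNReal.mul_rpow_of_nonneg _ _ hp0.le, ← ENNReal.rpow_mul, ← ENNReal.rpow_mul,
    one_div_mul_cancel hp0.ne', ENNReal.rpow_one, lintegral_Ioc_rpow_sub_one hε hT.le,
    ENNReal.ofReal_rpow_of_pos (by positivity), mul_comm]
  congr 3
  field_simp

/-- **Hardy's inequality** with a power weight, in the variable dual to the radius. -/
theorem lintegral_hardy_rpow {p β a : ℝ} (hp : 1 ≤ p) (hβ : 0 < β) (ha : 0 < a) :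
    ∃ C : ℝ≥0, ∀ h : ℝ → ℝ≥0∞, Measurable h →
      ∫⁻ s in Ioi (0 : ℝ), (∫⁻ r in Ioc 0 (a / s), h r) ^ p * ENNReal.ofReal (s ^ (β - 1)) ≤
        C * ∫⁻ r in Ioi (0 : ℝ), h r ^ p * ENNReal.ofReal (r ^ (p - 1 - β)) := by
  have hp0 : 0 < p := by linarith
  -- Any `ε > 0` with `ε * (p - 1) < β` serves.
  set ε := β / p with hε
  have hε0 : 0 < ε := by positivity
  set δ := β - ε * (p - 1) with hδ
  have hδ0 : 0 < δ := by
    have : δ = ε := by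
      rw [hδ, hε]
      field_simp
      ring
    rwa [this]
  set c := (a ^ ε / ε) ^ (p - 1) with hc
  have hc0 : 0 ≤ c := by positivity
  refine ⟨(c * (a ^ δ / δ)).toNNReal, fun h hh => ?_⟩
  set w : ℝ → ℝ≥0∞ := fun r => h r ^ p * ENNReal.ofReal (r ^ ((1 - ε) * (p - 1))) with hw
  have hwm : Measurable w := by fun_prop
  have hset : MeasurableSet {q : ℝ × ℝ | q.2 ≤ a / q.1} :=
    measurableSet_le measurable_snd (by fun_prop)
  calc ∫⁻ s in Ioi (0 : ℝ), (∫⁻ r in Ioc 0 (a / s), h r) ^ p * ENNReal.ofReal (s ^ (β - 1))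
      ≤ ∫⁻ s in Ioi (0 : ℝ), ∫⁻ r in Ioi (0 : ℝ), {q : ℝ × ℝ | q.2 ≤ a / q.1}.indicator
          (fun q => ENNReal.ofReal (c * q.1 ^ (δ - 1)) * w q.2) (s, r) := by
        refine setLIntegral_mono' measurableSet_Ioi fun s hs => ?_
        have hs : 0 < s := hs
        refine (mul_le_mul_left (lintegral_Ioc_rpow_le hp hε0 (div_pos ha hs) hh) _).trans
          (le_of_eq ?_)
        have h1 : ∀ r, {q : ℝ × ℝ | q.2 ≤ a / q.1}.indicator
          (fun q => ENNReal.ofReal (c * q.1 ^ (δ - 1)) * w q.2) (s, r) =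
            ENNReal.ofReal (c * s ^ (δ - 1)) * (Iic (a / s)).indicator w r := by
          intro r
          by_cases hr : r ≤ a / s <;> simp [hr]
        simp only [h1]
        rw [lintegral_const_mul _ (hwm.indicator measurableSet_Iic),
          lintegral_indicator measurableSet_Iic, Measure.restrict_restrict measurableSet_Iic,
          Iic_inter_Ioi, mul_right_comm, ← ENNReal.ofReal_mul (by positivity)]
        congr 2
        rw [hc, Real.div_rpow ha.le hs.le, div_right_comm, Real.div_rpow (by positivity)
          (by positivity), ← Real.rpow_mul hs.le, div_mul_eq_mul_div, mul_div_assoc,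
          ← Real.rpow_sub hs]
        congr 2
        rw [hδ]
        ring
    _ = ∫⁻ r in Ioi (0 : ℝ), ∫⁻ s in Ioi (0 : ℝ), {q : ℝ × ℝ | q.2 ≤ a / q.1}.indicator
          (fun q => ENNReal.ofReal (c * q.1 ^ (δ - 1)) * w q.2) (s, r) := by
        refine lintegral_lintegral_swap (Measurable.aemeasurable ?_)
        refine Measurable.indicator ?_ hset
        fun_prop
    _ = ∫⁻ r in Ioi (0 : ℝ), ENNReal.ofReal (c * (a ^ δ / δ)) *
          (h r ^ p * ENNReal.ofReal (r ^ (p - 1 - β))) := by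
        refine setLIntegral_congr_fun measurableSet_Ioi fun r hr => ?_
        have hr : 0 < r := hr
        have h1 : ∫⁻ s in Ioi (0 : ℝ), {q : ℝ × ℝ | q.2 ≤ a / q.1}.indicator
            (fun q => ENNReal.ofReal (c * q.1 ^ (δ - 1)) * w q.2) (s, r) =
            ∫⁻ s in Ioi (0 : ℝ), (Iic (a / r)).indicator
              (fun s => ENNReal.ofReal c * w r * ENNReal.ofReal (s ^ (δ - 1))) s := by
          refine setLIntegral_congr_fun measurableSet_Ioi fun s hs => ?_
          have hs : 0 < s := hs
          have hiff : r ≤ a / s ↔ s ≤ a / r := by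
            rw [le_div_iff₀ hs, le_div_iff₀ hr, mul_comm]
          by_cases h2 : s ≤ a / r
          · simp only [indicator, mem_ofPred_eq, mem_Iic, hiff, h2, if_true]
            rw [ENNReal.ofReal_mul hc0]
            ring
          · simp [indicator, hiff, h2]
        simp only [h1]
        rw [lintegral_indicator measurableSet_Iic, Measure.restrict_restrict measurableSet_Iic,
          Iic_inter_Ioi, lintegral_const_mul _ (by fun_prop),
          lintegral_Ioc_rpow_sub_one hδ0 (by positivity), hw]
        simp only
        rw [Real.div_rpow ha.le hr.le, ENNReal.ofReal_mul hc0]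
        have h3 : a ^ δ / r ^ δ / δ = a ^ δ / δ * r ^ (-δ) := by
          rw [Real.rpow_neg hr.le]
          ring
        have h4 : ENNReal.ofReal (r ^ (p - 1 - β)) =
            ENNReal.ofReal (r ^ ((1 - ε) * (p - 1))) * ENNReal.ofReal (r ^ (-δ)) := by
          rw [← ENNReal.ofReal_mul (by positivity), ← Real.rpow_add hr]
          congr 2
          rw [hδ]
          ring
        rw [h3, h4, ENNReal.ofReal_mul (by positivity)]
        ring
    _ = (c * (a ^ δ / δ)).toNNReal *
          ∫⁻ r in Ioi (0 : ℝ), h r ^ p * ENNReal.ofReal (r ^ (p - 1 - β)) := by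
        rw [lintegral_const_mul _ (by fun_prop)]
        rfl

/-! ### The pointwise bound for the Fourier transform -/

theorem AntitoneOn.nonneg_of_tendsto_zero {g : ℝ → ℝ} (hg : AntitoneOn g (Ioi 0))
    (hlim : Tendsto g atTop (𝓝 0)) {r : ℝ} (hr : 0 < r) : 0 ≤ g r := by
  refine le_of_tendsto hlim ?_
  filter_upwards [eventually_ge_atTop r] with t ht
  exact hg hr (hr.trans_le ht) ht

theorem AntitoneOn.measurable_indicator_Ioi {g : ℝ → ℝ} (hg : AntitoneOn g (Ioi 0)) :
    Measurable ((Ioi 0).indicator g) := by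
  have h1 : Antitone ((Ioi (0 : ℝ)).domRestrict g) := fun x y hxy => hg x.2 y.2 hxy
  refine measurable_of_restrict_of_restrict_compl (measurableSet_Ioi (a := (0 : ℝ))) ?_ ?_
  · convert h1.measurable using 1
    ext x
    exact indicator_of_mem x.2 g
  · convert (measurable_const : Measurable fun _ : ((Ioi (0 : ℝ))ᶜ : Set ℝ) => (0 : ℝ)) using 1
    ext x
    exact indicator_of_notMem x.2 g

/-- Integrals of `g q` converge at infinity when `g` tends to `0` and the tails obey a bound of
the kind given by the second mean value theorem. -/
theorem exists_tendsto_integral_of_tail_le {g : ℝ → ℝ}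
    (hlim : Tendsto g atTop (𝓝 0)) {F : ℝ → ℂ} {T K : ℝ} (hT : 0 < T)
    (hint : ∀ b, 0 < b → IntervalIntegrable F volume 0 b)
    (htail : ∀ a b, T ≤ a → a ≤ b → ‖∫ r in a..b, F r‖ ≤ g a * K) :
    ∃ L : ℂ, Tendsto (fun N => ∫ r in (0 : ℝ)..N, F r) atTop (𝓝 L) ∧
      ‖L‖ ≤ ‖∫ r in (0 : ℝ)..T, F r‖ + g T * K := by
  have hsub : ∀ a b, T ≤ a → a ≤ b →
      (∫ r in (0 : ℝ)..b, F r) - ∫ r in (0 : ℝ)..a, F r = ∫ r in a..b, F r := fun a b ha hab =>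
    intervalIntegral.integral_interval_sub_left (hint b (hT.trans_le (ha.trans hab)))
      (hint a (hT.trans_le ha))
  have hgK : Tendsto (fun r => g r * K) atTop (𝓝 0) := by simpa using hlim.mul_const K
  have hcauchy : CauchySeq fun N => ∫ r in (0 : ℝ)..N, F r := by
    rw [Metric.cauchySeq_iff']
    intro ε hε
    obtain ⟨N, hN, hN'⟩ := ((hgK.eventually (gt_mem_nhds hε)).and (eventually_ge_atTop T)).exists
    refine ⟨N, fun n hn => ?_⟩
    rw [dist_eq_norm, hsub N n hN' hn]
    exact (htail N n hN' hn).trans_lt hN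
  obtain ⟨L, hL⟩ := cauchySeq_tendsto_of_complete hcauchy
  refine ⟨L, hL, le_of_tendsto hL.norm ?_⟩
  filter_upwards [eventually_ge_atTop T] with N hN
  have h1 : ∫ r in (0 : ℝ)..N, F r = (∫ r in (0 : ℝ)..T, F r) + ∫ r in T..N, F r := by
    rw [← hsub T N le_rfl hN]
    ring
  rw [h1]
  exact (norm_add_le _ _).trans (add_le_add_right (htail T N le_rfl hN) _)

theorem AntitoneOn.norm_integral_mul_le {g : ℝ → ℝ} (hg : AntitoneOn g (Ioi 0))
    (hg0 : ∀ r, 0 < r → 0 ≤ g r) {k : ℝ → ℂ} {a b M : ℝ} (ha : 0 < a)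
    (hab : a ≤ b) (hk : IntegrableOn k (Ioc a b))
    (hM : ∀ x ∈ Icc a b, ‖∫ r in a..x, k r‖ ≤ M) :
    ‖∫ r in a..b, (g r : ℂ) * k r‖ ≤ g a * M := by
  have hpos : ∀ r, 0 < max a r := fun r => ha.trans_le (le_max_left _ _)
  have h := norm_integral_antitone_mul_le (g := fun r => g (max a r))
    (fun x y hxy => hg (hpos x) (hpos y) (max_le_max le_rfl hxy)) (fun r => hg0 _ (hpos r))
    hab hk hM
  simp only [max_self] at h
  refine le_trans (le_of_eq ?_) h
  congr 1
  refine intervalIntegral.integral_congr fun r hr => ?_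
  rw [uIcc_of_le hab] at hr
  simp only [max_eq_right hr.1]

section Euclidean

variable {n : ℕ}

theorem integrableOn_closedBall_of_radial [Nontrivial (EuclideanSpace ℝ (Fin n))]
    {f : EuclideanSpace ℝ (Fin n) → ℝ} {f₀ : ℝ → ℝ} (hf : ∀ x, f x = f₀ ‖x‖) {N : ℝ}
    (hint : IntegrableOn (fun r => f₀ r * r ^ (n - 1)) (Ioc 0 N)) :
    IntegrableOn f (Metric.closedBall 0 N) := by
  rw [← integrable_indicator_iff Metric.isClosed_closedBall.measurableSet]
  have heq : (Metric.closedBall 0 N).indicator f = fun x => (Iic N).indicator f₀ ‖x‖ := by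
    ext x
    simp [indicator, hf]
  rw [heq, integrable_fun_norm_addHaar volume (f := (Iic N).indicator f₀),
    finrank_euclideanSpace_fin]
  have h1 : (fun r : ℝ => r ^ (n - 1) • (Iic N).indicator f₀ r) =
      (Iic N).indicator fun r => f₀ r * r ^ (n - 1) := by
    ext r
    by_cases hr : r ≤ N <;> simp [hr, mul_comm]
  rw [h1, IntegrableOn, integrable_indicator_iff measurableSet_Iic, IntegrableOn,
    Measure.restrict_restrict measurableSet_Iic, Iic_inter_Ioi]
  exact hint

/-- The truncated Fourier transform of a radial function as a one-dimensional integral. -/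
theorem ballFourier_eq_integral_sphereWave [Nontrivial (EuclideanSpace ℝ (Fin n))]
    {f : EuclideanSpace ℝ (Fin n) → ℝ} {f₀ : ℝ → ℝ} (hf : ∀ x, f x = f₀ ‖x‖) {N : ℝ} (hN : 0 ≤ N)
    (hint : IntegrableOn (fun r => f₀ r * r ^ (n - 1)) (Ioc 0 N))
    {ξ : EuclideanSpace ℝ (Fin n)} (hξ : ξ ≠ 0) :
    ballFourier f N ξ = ∫ r in (0 : ℝ)..N, ((f₀ r * r ^ (n - 1) : ℝ) : ℂ) *
      sphereWave (‖ξ‖⁻¹ • ξ) 0 (2 * Real.pi * ‖ξ‖ * r) := by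
  have hb : Integrable ((Metric.closedBall (0 : EuclideanSpace ℝ (Fin n)) N).indicator
      fun x => (f x : ℂ)) := by
    rw [integrable_indicator_iff Metric.isClosed_closedBall.measurableSet]
    exact (integrableOn_closedBall_of_radial hf hint).ofReal
  have hξ0 : ‖ξ‖ ≠ 0 := norm_ne_zero_iff.2 hξ
  have hF : Integrable fun x : EuclideanSpace ℝ (Fin n) =>
      Complex.exp (((-2 * Real.pi * inner ℝ x ξ : ℝ) : ℂ) * Complex.I) •
      (Metric.closedBall (0 : EuclideanSpace ℝ (Fin n)) N).indicator (fun x => (f x : ℂ)) x := by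
    simp only [smul_eq_mul]
    exact hb.bdd_mul (c := 1) (Continuous.aestronglyMeasurable (by fun_prop))
      (Eventually.of_forall fun x => (Complex.norm_exp_ofReal_mul_I _).le)
  rw [ballFourier, Real.fourier_eq', integral_eq_integral_Ioi_toSphere volume hF,
    finrank_euclideanSpace_fin, intervalIntegral.integral_of_le hN, ← Iic_inter_Ioi,
    ← Measure.restrict_restrict measurableSet_Iic, ← integral_indicator measurableSet_Iic]
  refine setIntegral_congr_fun measurableSet_Ioi fun r hr => ?_
  have hr : 0 < r := hr
  have hnorm : ∀ ω : Metric.sphere (0 : EuclideanSpace ℝ (Fin n)) 1,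
      ‖r • (ω : EuclideanSpace ℝ (Fin n))‖ = r := fun ω => by simp [norm_smul, abs_of_pos hr]
  simp only
  by_cases hrN : r ≤ N
  · rw [indicator_of_mem (mem_Iic.2 hrN), sphereWave, ← integral_const_mul, ← integral_smul]
    refine integral_congr_ae (Eventually.of_forall fun ω => ?_)
    have hmem : r • (ω : EuclideanSpace ℝ (Fin n)) ∈ Metric.closedBall 0 N := by
      rw [mem_closedBall_zero_iff, hnorm]
      exact hrN
    simp only [indicator_of_mem hmem, hf, hnorm, pow_zero, one_mul, real_inner_smul_left,
      real_inner_smul_right]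
    have harg : -2 * Real.pi * (r * inner ℝ (ω : EuclideanSpace ℝ (Fin n)) ξ) =
        -(2 * Real.pi * ‖ξ‖ * r * (‖ξ‖⁻¹ * inner ℝ (ω : EuclideanSpace ℝ (Fin n)) ξ)) := by
      field_simp
    rw [harg]
    simp only [smul_eq_mul, Complex.real_smul]
    push_cast
    ring
  · rw [indicator_of_notMem (by simpa using hrN)]
    have hnot : ∀ ω : Metric.sphere (0 : EuclideanSpace ℝ (Fin n)) 1,
        r • (ω : EuclideanSpace ℝ (Fin n)) ∉ Metric.closedBall 0 N := fun ω => by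
      rw [mem_closedBall_zero_iff, hnorm]
      exact hrN
    simp [hnot]

theorem exists_norm_integral_rpow_mul_sphereWave_dilate_le
    [Nontrivial (EuclideanSpace ℝ (Fin n))] {k : ℝ} (hk : 2 * k = (n : ℝ) - 1) :
    ∃ M : ℝ, 0 ≤ M ∧ ∀ θ : EuclideanSpace ℝ (Fin n), ‖θ‖ = 1 → ∀ s : ℝ, 0 < s →
      ∀ a b : ℝ, s⁻¹ ≤ a → a ≤ b →
      ‖∫ r in a..b, ((r ^ k : ℝ) : ℂ) * sphereWave θ 0 (s * r)‖ ≤ M * s⁻¹ ^ (k + 1) := by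
  obtain ⟨M, hM0, hM⟩ := exists_norm_integral_rpow_mul_sphereWave_le
    (E := EuclideanSpace ℝ (Fin n)) (k := k) (by rw [finrank_euclideanSpace_fin, hk])
  refine ⟨2 * M, by positivity, fun θ hθ s hs a b ha hab => ?_⟩
  have ha0 : 0 < a := (inv_pos.2 hs).trans_le ha
  have hsa : 1 ≤ s * a := by
    have := mul_le_mul_of_nonneg_left ha hs.le
    rwa [mul_inv_cancel₀ hs.ne'] at this
  have hsab : s * a ≤ s * b := mul_le_mul_of_nonneg_left hab hs.le
  have hint : ∀ x, 1 ≤ x → IntervalIntegrable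
      (fun r : ℝ => ((r ^ k : ℝ) : ℂ) * sphereWave θ 0 r) volume 1 x := fun x hx => by
    refine ContinuousOn.intervalIntegrable fun r hr => ContinuousAt.continuousWithinAt ?_
    rw [uIcc_of_le hx] at hr
    have hr0 : r ≠ 0 := (one_pos.trans_le hr.1).ne'
    exact (Complex.continuous_ofReal.continuousAt.comp
      (Real.continuousAt_rpow_const r k (Or.inl hr0))).mul
      (hasDerivAt_sphereWave hθ 0 r).continuousAt
  have h1 : ∫ r in a..b, ((r ^ k : ℝ) : ℂ) * sphereWave θ 0 (s * r) =
      ((s⁻¹ ^ (k + 1) : ℝ) : ℂ) *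
        ∫ r in (s * a)..(s * b), ((r ^ k : ℝ) : ℂ) * sphereWave θ 0 r := by
    have h2 := intervalIntegral.integral_comp_mul_left (a := a) (b := b)
      (fun r : ℝ => ((r ^ k : ℝ) : ℂ) * sphereWave θ 0 r) hs.ne'
    have h3 : s⁻¹ ^ (k + 1) = s⁻¹ ^ k * s⁻¹ := by
      rw [Real.rpow_add_one (inv_ne_zero hs.ne')]
    rw [h3, Complex.ofReal_mul, mul_assoc, ← Complex.real_smul (x := s⁻¹), ← h2,
      ← intervalIntegral.integral_const_mul]
    refine intervalIntegral.integral_congr fun r hr => ?_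
    rw [uIcc_of_le hab] at hr
    have hr0 : 0 ≤ r := ha0.le.trans hr.1
    simp only
    rw [← mul_assoc, ← Complex.ofReal_mul, ← Real.mul_rpow (by positivity) (by positivity),
      inv_mul_cancel_left₀ hs.ne']
  rw [h1, norm_mul, Complex.norm_real, Real.norm_of_nonneg (by positivity), mul_comm]
  refine mul_le_mul_of_nonneg_right ?_ (by positivity)
  rw [← intervalIntegral.integral_interval_sub_left (hint _ (hsa.trans hsab)) (hint _ hsa)]
  refine (norm_sub_le _ _).trans ?_
  have := hM θ hθ _ hsa
  have := hM θ hθ _ (hsa.trans hsab)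
  linarith

/-- Only the part of `f` inside the ball of radius `1 / (2 π ‖ξ‖)` contributes to the size of the
Fourier transform at `ξ`: there the plane wave is bounded trivially, and outside its oscillation
against the monotone profile is controlled by the value of the profile on the bounding sphere. -/
theorem exists_tendsto_ballFourier_norm_le [Nontrivial (EuclideanSpace ℝ (Fin n))] (hn : 1 ≤ n) :
    ∃ C : ℝ, 0 ≤ C ∧ ∀ (f : EuclideanSpace ℝ (Fin n) → ℝ) (f₀ : ℝ → ℝ),
      (∀ x, f x = f₀ ‖x‖) →
      AntitoneOn (fun r : ℝ => f₀ r * r ^ (((n : ℝ) - 1) / 2)) (Ioi 0) →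
      Tendsto (fun r : ℝ => f₀ r * r ^ (((n : ℝ) - 1) / 2)) atTop (𝓝 0) →
      (∀ T, IntegrableOn (fun r => f₀ r * r ^ (n - 1)) (Ioc 0 T)) →
      ∀ ξ : EuclideanSpace ℝ (Fin n), ξ ≠ 0 → ∃ L : ℂ,
        Tendsto (fun N => ballFourier f N ξ) atTop (𝓝 L) ∧
        ‖L‖ ≤ C * ∫ r in Ioc 0 (2 * Real.pi * ‖ξ‖)⁻¹, f₀ r * r ^ (n - 1) := by
  set k : ℝ := ((n : ℝ) - 1) / 2 with hk
  have hk0 : 0 ≤ k := by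
    have : (1 : ℝ) ≤ n := by exact_mod_cast hn
    rw [hk]
    linarith
  obtain ⟨M, hM0, hM⟩ := exists_norm_integral_rpow_mul_sphereWave_dilate_le (n := n) (k := k)
    (by rw [hk]; ring)
  set V := (volume : Measure (EuclideanSpace ℝ (Fin n))).toSphere.real univ
  have hV : 0 ≤ V := measureReal_nonneg
  refine ⟨V + M * (k + 1), by positivity, fun f f₀ hf hanti hlim hloc ξ hξ => ?_⟩
  set g : ℝ → ℝ := fun r => f₀ r * r ^ k with hg
  have hξ0 : 0 < ‖ξ‖ := norm_pos_iff.2 hξ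
  set θ := ‖ξ‖⁻¹ • ξ with hθdef
  have hθ : ‖θ‖ = 1 := by
    rw [hθdef, norm_smul, norm_inv, norm_norm, inv_mul_cancel₀ hξ0.ne']
  set s := 2 * Real.pi * ‖ξ‖ with hs
  have hs0 : 0 < s := by positivity
  set T := s⁻¹ with hT
  have hT0 : 0 < T := inv_pos.2 hs0
  have hg0 : ∀ r, 0 < r → 0 ≤ g r := fun r hr => hanti.nonneg_of_tendsto_zero hlim hr
  have hprof : ∀ r, 0 < r → f₀ r * r ^ (n - 1) = g r * r ^ k := fun r hr => by
    rw [hg, mul_assoc, ← Real.rpow_add hr, ← Real.rpow_natCast, Nat.cast_sub hn]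
    congr 2
    rw [hk]
    push_cast
    ring
  have hW : Continuous fun r : ℝ => sphereWave θ 0 (s * r) := by
    have : Continuous (sphereWave θ 0) := continuous_iff_continuousAt.2 fun r =>
      (hasDerivAt_sphereWave hθ 0 r).continuousAt
    fun_prop
  set F : ℝ → ℂ := fun r => ((f₀ r * r ^ (n - 1) : ℝ) : ℂ) * sphereWave θ 0 (s * r) with hF
  have hFnorm : ∀ r, 0 < r → ‖F r‖ ≤ f₀ r * r ^ (n - 1) * V := fun r hr => by
    have h0 : 0 ≤ f₀ r * r ^ (n - 1) := by
      rw [hprof r hr]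
      exact mul_nonneg (hg0 r hr) (Real.rpow_nonneg hr.le _)
    rw [hF, norm_mul, Complex.norm_real, Real.norm_of_nonneg h0]
    exact mul_le_mul_of_nonneg_left (norm_sphereWave_le hθ 0 _) h0
  have hFint : ∀ b, 0 < b → IntervalIntegrable F volume 0 b := fun b hb => by
    rw [intervalIntegrable_iff_integrableOn_Ioc_of_le hb.le]
    exact (hloc b).ofReal.mul_bdd (c := V) hW.aestronglyMeasurable
      (Eventually.of_forall fun r => norm_sphereWave_le hθ 0 _)
  have htail : ∀ a b, T ≤ a → a ≤ b → ‖∫ r in a..b, F r‖ ≤ g a * (M * T ^ (k + 1)) := by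
    intro a b ha hab
    have ha0 : 0 < a := hT0.trans_le ha
    have heq : ∫ r in a..b, F r =
        ∫ r in a..b, (g r : ℂ) * (((r ^ k : ℝ) : ℂ) * sphereWave θ 0 (s * r)) := by
      refine intervalIntegral.integral_congr fun r hr => ?_
      rw [uIcc_of_le hab] at hr
      simp only [hF]
      rw [hprof r (ha0.trans_le hr.1), Complex.ofReal_mul, mul_assoc]
    rw [heq]
    refine hanti.norm_integral_mul_le hg0 ha0 hab ?_
      fun x hx => hM θ hθ s hs0 a x ha hx.1
    have hc : ContinuousOn (fun r : ℝ => ((r ^ k : ℝ) : ℂ) * sphereWave θ 0 (s * r))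
        (Icc a b) := by
      refine (Complex.continuous_ofReal.comp_continuousOn ?_).mul hW.continuousOn
      exact (Real.continuous_rpow_const hk0).continuousOn
    exact hc.integrableOn_Icc.mono_set Ioc_subset_Icc_self
  obtain ⟨L, hL, hLnorm⟩ := exists_tendsto_integral_of_tail_le hlim hT0 hFint htail
  refine ⟨L, hL.congr' ?_, hLnorm.trans ?_⟩
  · filter_upwards [eventually_ge_atTop 0] with N hN
    rw [ballFourier_eq_integral_sphereWave hf hN (hloc N) hξ]
  · rw [add_mul]
    refine add_le_add ?_ ?_
    · rw [intervalIntegral.integral_of_le hT0.le, mul_comm, ← integral_mul_const]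
      refine norm_integral_le_of_norm_le ((hloc T).mul_const V) ?_
      filter_upwards [ae_restrict_mem measurableSet_Ioc] with r hr
      exact hFnorm r hr.1
    · -- Monotonicity bounds `g T` by the average of `g` over `(0, T]` with weight `r ^ k`.
      have hrk : ∫ r in Ioc 0 T, r ^ k = T ^ (k + 1) / (k + 1) := by
        rw [← intervalIntegral.integral_of_le hT0.le, integral_rpow (Or.inl (by linarith)),
          Real.zero_rpow (by positivity), sub_zero]
      have hle : g T * (T ^ (k + 1) / (k + 1)) ≤ ∫ r in Ioc 0 T, f₀ r * r ^ (n - 1) := by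
        rw [← hrk, ← integral_const_mul]
        refine setIntegral_mono_on ?_ (hloc T) measurableSet_Ioc fun r hr => ?_
        · exact ((intervalIntegral.intervalIntegrable_rpow' (by linarith)).1).const_mul _
        · rw [hprof r hr.1]
          exact mul_le_mul_of_nonneg_right (hanti hr.1 hT0 hr.2) (Real.rpow_nonneg hr.1.le _)
      calc g T * (M * T ^ (k + 1)) = M * (k + 1) * (g T * (T ^ (k + 1) / (k + 1))) := by
            field_simp
        _ ≤ _ := mul_le_mul_of_nonneg_left hle (by positivity)

end Euclidean

/-! ### Pitt's inequality -/

theorem measurable_lintegral_Ioc_div (h : ℝ → ℝ≥0∞) (a : ℝ) :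
    Measurable fun s : ℝ => ∫⁻ r in Ioc 0 (a / s), h r := by
  have hmono : Monotone fun T : ℝ => ∫⁻ r in Ioc 0 T, h r := fun T T' hT =>
    lintegral_mono_set (Ioc_subset_Ioc_right hT)
  exact hmono.measurable.comp (by fun_prop : Measurable fun s : ℝ => a / s)

theorem lintegral_Ioc_ne_top_of_lintegral_rpow_ne_top {p β a : ℝ} (hp : 1 ≤ p) (ha : 0 < a)
    {h : ℝ → ℝ≥0∞}
    (hfin : ∫⁻ s in Ioi (0 : ℝ), (∫⁻ r in Ioc 0 (a / s), h r) ^ p *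
      ENNReal.ofReal (s ^ (β - 1)) ≠ ⊤) (T : ℝ) :
    ∫⁻ r in Ioc 0 T, h r ≠ ⊤ := by
  have hm := measurable_lintegral_Ioc_div h a
  have hae := ae_lt_top (by fun_prop) hfin
  rw [ae_restrict_iff' measurableSet_Ioi] at hae
  have hT : 0 < a / max T 1 := div_pos ha (one_pos.trans_le (le_max_right _ _))
  obtain ⟨s, hs, hlt⟩ : ∃ s ∈ Ioo 0 (a / max T 1),
      (∫⁻ r in Ioc 0 (a / s), h r) ^ p * ENNReal.ofReal (s ^ (β - 1)) < ⊤ := by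
    by_contra! hcon
    have h0 : volume (Ioo 0 (a / max T 1)) = 0 := by
      refine measure_mono_null (fun s hs => ?_) hae
      exact fun h' => (h' hs.1).not_ge (hcon s hs)
    rw [Real.volume_Ioo, ENNReal.ofReal_eq_zero] at h0
    linarith
  have hTs : T ≤ a / s := by
    refine (le_max_left T 1).trans ?_
    rw [le_div_iff₀ hs.1, mul_comm, ← le_div_iff₀ (one_pos.trans_le (le_max_right _ _))]
    exact hs.2.le
  intro htop
  have htop' : ∫⁻ r in Ioc 0 (a / s), h r = ⊤ :=
    top_unique (htop ▸ lintegral_mono_set (Ioc_subset_Ioc_right hTs))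
  rw [htop', ENNReal.top_rpow_of_pos (by linarith), ENNReal.top_mul] at hlt
  · exact lt_irrefl _ hlt
  · exact (ENNReal.ofReal_pos.2 (Real.rpow_pos_of_pos hs.1 _)).ne'

theorem mainTheorem5 (n : ℕ) (hn : 1 ≤ n) (p : ℝ) (hp : 1 ≤ p) (γ : ℝ)
    (hγ : γ < (n : ℝ) * (1 - 1 / p)) :
    ∃ C : ℝ≥0, ∀ (f : EuclideanSpace ℝ (Fin n) → ℝ) (f₀ : ℝ → ℝ),
      (∀ x, f x = f₀ ‖x‖) →
      AntitoneOn (fun r : ℝ => f₀ r * r ^ (((n : ℝ) - 1) / 2)) (Ioi 0) →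
      Tendsto (fun r : ℝ => f₀ r * r ^ (((n : ℝ) - 1) / 2)) atTop (𝓝 0) →
      ((∫⁻ x, ‖f x‖ₑ ^ p * ENNReal.ofReal (‖x‖ ^ (γ * p)) ≠ ⊤ →
          LocallyIntegrable f ∧
          ∀ ξ : EuclideanSpace ℝ (Fin n), ξ ≠ 0 →
            Tendsto (fun N : ℝ => ballFourier f N ξ) atTop (𝓝 (radialFourier f ξ))) ∧
        ∫⁻ ξ, ‖radialFourier f ξ‖ₑ ^ p *
            ENNReal.ofReal (‖ξ‖ ^ ((n : ℝ) * (p - 2) - γ * p)) ≤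
          C * ∫⁻ x, ‖f x‖ₑ ^ p * ENNReal.ofReal (‖x‖ ^ (γ * p))) := by
  have hp0 : 0 < p := by linarith
  have : Nontrivial (EuclideanSpace ℝ (Fin n)) :=
    Module.nontrivial_of_finrank_pos (R := ℝ) (by rw [finrank_euclideanSpace_fin]; omega)
  have hcast : ((n - 1 : ℕ) : ℝ) = (n : ℝ) - 1 := by
    rw [Nat.cast_sub hn, Nat.cast_one]
  set β : ℝ := n * p - n - γ * p with hβ
  have hβ0 : 0 < β := by
    have h1 := mul_lt_mul_of_pos_right hγ hp0
    have h2 : (n : ℝ) * (1 - 1 / p) * p = n * p - n := by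
      field_simp
    rw [hβ]
    linarith
  set a : ℝ := (2 * Real.pi)⁻¹ with ha
  have ha0 : 0 < a := by positivity
  obtain ⟨C₁, hC₁0, hC₁⟩ := exists_tendsto_ballFourier_norm_le hn
  obtain ⟨C₂, hC₂⟩ := lintegral_hardy_rpow hp hβ0 ha0
  -- The summand `1` makes the constant positive, so that an infinite right-hand side stays infinite.
  refine ⟨C₁.toNNReal ^ p * C₂ + 1, fun f f₀ hf hanti hlim => ?_⟩
  have hg0 : ∀ r, 0 < r → 0 ≤ f₀ r := fun r hr =>
    nonneg_of_mul_nonneg_left (hanti.nonneg_of_tendsto_zero hlim hr) (Real.rpow_pos_of_pos hr _)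
  -- A measurable version of the profile; it differs from `f₀` outside `(0, ∞)` only.
  set f₁ : ℝ → ℝ := (Ioi 0).indicator f₀ with hf₁
  have hf₁m : Measurable f₁ := by
    have h1 := hanti.measurable_indicator_Ioi.mul
      (by fun_prop : Measurable fun r : ℝ => r ^ (-(((n : ℝ) - 1) / 2)))
    convert h1 using 1
    ext r
    by_cases hr : 0 < r
    · simp only [hf₁, Pi.mul_apply, indicator_of_mem (mem_Ioi.2 hr)]
      rw [mul_assoc, ← Real.rpow_add hr, add_neg_cancel, Real.rpow_zero, mul_one]
    · simp [hf₁, hr]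
  have hf₁eq : ∀ r, 0 < r → f₁ r = f₀ r := fun r hr => indicator_of_mem (mem_Ioi.2 hr) _
  set h : ℝ → ℝ≥0∞ := fun r => ENNReal.ofReal (f₁ r * r ^ (n - 1)) with hh
  have hhm : Measurable h := by fun_prop
  set σ := (volume : Measure (EuclideanSpace ℝ (Fin n))).toSphere univ
  have hne : ∀ᵐ x : EuclideanSpace ℝ (Fin n), x ≠ 0 := by simp [ae_iff]
  have hRHS : ∫⁻ x, ‖f x‖ₑ ^ p * ENNReal.ofReal (‖x‖ ^ (γ * p)) =
      σ * ∫⁻ r in Ioi (0 : ℝ), h r ^ p * ENNReal.ofReal (r ^ (p - 1 - β)) := by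
    have h1 : ∫⁻ x, ‖f x‖ₑ ^ p * ENNReal.ofReal (‖x‖ ^ (γ * p)) =
        ∫⁻ x : EuclideanSpace ℝ (Fin n),
          ‖f₁ ‖x‖‖ₑ ^ p * ENNReal.ofReal (‖x‖ ^ (γ * p)) := by
      refine lintegral_congr_ae ?_
      filter_upwards [hne] with x hx
      rw [hf, hf₁eq _ (norm_pos_iff.2 hx)]
    rw [h1, lintegral_fun_norm_eq volume
      (F := fun r => ‖f₁ r‖ₑ ^ p * ENNReal.ofReal (r ^ (γ * p))) (by fun_prop),
      finrank_euclideanSpace_fin]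
    congr 1
    refine setLIntegral_congr_fun measurableSet_Ioi fun r hr => ?_
    have hr : 0 < r := hr
    have hf0 : 0 ≤ f₀ r := hg0 r hr
    simp only [hh]
    rw [hf₁eq r hr, Real.enorm_of_nonneg hf0,
      ENNReal.ofReal_rpow_of_nonneg hf0 hp0.le,
      ENNReal.ofReal_rpow_of_nonneg (by positivity) hp0.le,
      ← ENNReal.ofReal_mul (by positivity), ← ENNReal.ofReal_mul (by positivity),
      ← ENNReal.ofReal_mul (by positivity), Real.mul_rpow hf0 (by positivity),
      ← Real.rpow_natCast r, ← Real.rpow_mul hr.le, mul_left_comm, ← Real.rpow_add hr, mul_assoc,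
      ← Real.rpow_add hr, hcast]
    congr 3
    rw [hβ]
    ring
  by_cases hfin : ∫⁻ x, ‖f x‖ₑ ^ p * ENNReal.ofReal (‖x‖ ^ (γ * p)) = ⊤
  · refine ⟨fun h' => absurd hfin h', ?_⟩
    rw [hfin, ENNReal.mul_top]
    · exact le_top
    · simp
  have hσ0 : σ ≠ 0 := Measure.measure_univ_ne_zero.2 (Measure.toSphere_ne_zero _)
  have hI : ∫⁻ r in Ioi (0 : ℝ), h r ^ p * ENNReal.ofReal (r ^ (p - 1 - β)) ≠ ⊤ := fun htop => by
    rw [hRHS, htop, ENNReal.mul_top hσ0] at hfin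
    exact hfin rfl
  have hHardy := hC₂ h hhm
  have hHfin := ne_top_of_le_ne_top (ENNReal.mul_ne_top ENNReal.coe_ne_top hI) hHardy
  have hloc : ∀ T, IntegrableOn (fun r => f₀ r * r ^ (n - 1)) (Ioc 0 T) := fun T => by
    have h1 : IntegrableOn (fun r => f₁ r * r ^ (n - 1)) (Ioc 0 T) := by
      refine (lintegral_ofReal_ne_top_iff_integrable (by fun_prop) ?_).1
        (lintegral_Ioc_ne_top_of_lintegral_rpow_ne_top hp ha0 hHfin T)
      filter_upwards [ae_restrict_mem measurableSet_Ioc] with r hr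
      rw [hf₁eq r hr.1]
      exact mul_nonneg (hg0 r hr.1) (pow_nonneg hr.1.le _)
    refine h1.congr_fun (fun r hr => ?_) measurableSet_Ioc
    simp only [hf₁eq r hr.1]
  have hconv := hC₁ f f₀ hf hanti hlim hloc
  have htend : ∀ ξ : EuclideanSpace ℝ (Fin n), ξ ≠ 0 →
      Tendsto (fun N : ℝ => ballFourier f N ξ) atTop (𝓝 (radialFourier f ξ)) := fun ξ hξ => by
    obtain ⟨L, hL, -⟩ := hconv ξ hξ
    have : radialFourier f ξ = L := hL.limUnder_eq
    rwa [this]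
  have hbound : ∀ ξ : EuclideanSpace ℝ (Fin n), ξ ≠ 0 →
      ‖radialFourier f ξ‖ₑ ≤ C₁.toNNReal * ∫⁻ r in Ioc 0 (a / ‖ξ‖), h r := fun ξ hξ => by
    obtain ⟨L, hL, hLn⟩ := hconv ξ hξ
    have hLeq : radialFourier f ξ = L := hL.limUnder_eq
    have hT : (2 * Real.pi * ‖ξ‖)⁻¹ = a / ‖ξ‖ := by
      rw [ha, mul_inv, div_eq_mul_inv]
    rw [hT] at hLn
    rw [hLeq, ← ofReal_norm]
    refine (ENNReal.ofReal_le_ofReal hLn).trans (le_of_eq ?_)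
    rw [ENNReal.ofReal_mul hC₁0, ofReal_integral_eq_lintegral_ofReal (hloc _)]
    · congr 1
      refine setLIntegral_congr_fun measurableSet_Ioc fun r hr => ?_
      simp only [hh, hf₁eq r hr.1]
    · filter_upwards [ae_restrict_mem measurableSet_Ioc] with r hr
      exact mul_nonneg (hg0 r hr.1) (pow_nonneg hr.1.le _)
  refine ⟨fun _ => ⟨?_, htend⟩, ?_⟩
  · rw [locallyIntegrable_iff]
    intro K hK
    obtain ⟨N, hN⟩ := hK.isBounded.subset_closedBall 0
    exact (integrableOn_closedBall_of_radial hf (hloc N)).mono_set hN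
  have hHm := measurable_lintegral_Ioc_div h a
  calc ∫⁻ ξ, ‖radialFourier f ξ‖ₑ ^ p * ENNReal.ofReal (‖ξ‖ ^ ((n : ℝ) * (p - 2) - γ * p))
      ≤ ∫⁻ ξ : EuclideanSpace ℝ (Fin n), (C₁.toNNReal : ℝ≥0∞) ^ p *
          ((∫⁻ r in Ioc 0 (a / ‖ξ‖), h r) ^ p *
            ENNReal.ofReal (‖ξ‖ ^ ((n : ℝ) * (p - 2) - γ * p))) := by
        refine lintegral_mono_ae ?_
        filter_upwards [hne] with ξ hξ
        rw [← mul_assoc, ← ENNReal.mul_rpow_of_nonneg _ _ hp0.le]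
        exact mul_le_mul_left (ENNReal.rpow_le_rpow (hbound ξ hξ) hp0.le) _
    _ = σ * ((C₁.toNNReal : ℝ≥0∞) ^ p * ∫⁻ s in Ioi (0 : ℝ),
          (∫⁻ r in Ioc 0 (a / s), h r) ^ p * ENNReal.ofReal (s ^ (β - 1))) := by
        rw [lintegral_fun_norm_eq volume
          (F := fun s => (C₁.toNNReal : ℝ≥0∞) ^ p * ((∫⁻ r in Ioc 0 (a / s), h r) ^ p *
            ENNReal.ofReal (s ^ ((n : ℝ) * (p - 2) - γ * p)))) (by fun_prop),
          finrank_euclideanSpace_fin,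
          ← lintegral_const_mul ((C₁.toNNReal : ℝ≥0∞) ^ p) (by fun_prop)]
        congr 1
        refine setLIntegral_congr_fun measurableSet_Ioi fun s hs => ?_
        have hs : 0 < s := hs
        have hexp : ENNReal.ofReal (s ^ (β - 1)) = ENNReal.ofReal (s ^ (n - 1)) *
            ENNReal.ofReal (s ^ ((n : ℝ) * (p - 2) - γ * p)) := by
          rw [← ENNReal.ofReal_mul (by positivity), ← Real.rpow_natCast, ← Real.rpow_add hs, hcast]
          congr 2
          rw [hβ]
          ring
        rw [hexp]
        ring
    _ ≤ σ * ((C₁.toNNReal : ℝ≥0∞) ^ p *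
          (C₂ * ∫⁻ r in Ioi (0 : ℝ), h r ^ p * ENNReal.ofReal (r ^ (p - 1 - β)))) := by
        gcongr
    _ = (C₁.toNNReal : ℝ≥0∞) ^ p * C₂ *
          ∫⁻ x, ‖f x‖ₑ ^ p * ENNReal.ofReal (‖x‖ ^ (γ * p)) := by
        rw [hRHS]
        ring
    _ ≤ _ := by
        refine mul_le_mul_left ?_ _
        rw [ENNReal.coe_add, ENNReal.coe_mul, ENNReal.coe_rpow_of_nonneg _ hp0.le]
        exact le_self_add
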